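/- Let $G$ be a countably infinite set and let $W=(W_{ij})_{i,j\in G}$ be a real symmetric matrix (the weighted adjacency operator of an undirected graph on $G$ in which $j$ is a neighbour of $i$ when $W_{ij}\neq 0$). Assume that the maximal number of neighbours $\deg$ of a vertex is finite and that $|W_{ij}|\le 1/\deg$ for all $i,j$. Then $(Wu)_i=\sum_j W_{ij}u_j$ defines a bounded self-adjoint operator on $\ell^2(G)$ with norm at most $1$. Let $\operatorname{Sp}(W)\subset[-1,1]$ be its spectrum, $E$ its resolution of the identity, and, for $i\in G$, let $\mu_{ii}(\omega)=\langle E(\omega)\delta_i,\delta_i\rangle$ be the spectral measure of $W$ at the unit vector $\delta_i$, a probability measure on $\operatorname{Sp}(W)$. For a continuous function $f$ on $\operatorname{Sp}(W)$ let $\mathcal K(f)=f(W)=\int f\,dE$. For a function $f$ with an expansion $f(x)=\sum_{k\ge 0}f_kx^k$ on $\operatorname{Sp}(W)$ let $\alpha(f)=\sum_{k\ge 0}|f_k|(k+1)\in[0,\infty]$ (the infimum over all such expansions if the coefficients are not unique; $\alpha(f)=\infty$ if there is none). For $\rho>0$ let $\mathcal F_\rho$ be the set of positive real-analytic functions $g$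 on the convex hull of $\operatorname{Sp}(W)$ such that $\alpha(\log g)\le\rho$. Let $(G_n)_{n\in\mathbb N}$ be a nested sequence of finite subsets of $G$, $G_n\subset G_{n+1}$, let $m_n=\operatorname{Card}(G_n)$, let $\delta_n=\operatorname{Card}\{i\in G_n:\ \exists j\in G\setminus G_n,\ W_{ij}\ne 0\}$, and let $\mathcal K_n(f)=(\mathcal K(f)_{ij})_{i,j\in G_n}$. Assume that 1. $\delta_n=o(m_n)$ as $n\to\infty$; 2. there is a finite positive measure $\mu$ on $\operatorname{Sp}(W)$ such that $\frac1{m_n}\sum_{i\in G_n}\mu_{ii}$ converges to $\mu$ in distribution (weakly). Then for every $\rho>0$ and every $g\in\mathcal F_\rho$ the determinants $\det\mathcal K_n(g)$ are positive, $\log g$ is $\mu$-integrable, and $$\frac1{m_n}\log\det\mathcal K_n(g)\ \xrightarrow[n\to\infty]{}\ \int\log g\,d\mu .$$ -/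

import Mathlib

open MeasureTheory Filter Topology
open scoped ENNReal NNReal CompactlySupported InnerProductSpace

noncomputable section

/-- An undirected weighted graph on the vertex set `G`, of bounded degree, with renormalized
weights: `W` is symmetric, `i` and `j` are neighbors when `W i j ≠ 0`, the maximal number of
neighbors `deg` is finite, and the entries of `W` lie in `[-1/deg, 1/deg]`. -/
structure WeightedGraph (G : Type*) where
  W : G → G → ℝ
  symm : ∀ i j, W i j = W j i
  deg_lt_top : (⨆ i, {j | W i j ≠ 0}.encard) < ⊤
  abs_le : ∀ i j, |W i j| ≤ 1 / ((⨆ i, {j | W i j ≠ 0}.encard).toNat : ℝ)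

/-- The Hilbert space `ℓ²(G)` of square summable families, with complex scalars so that spectra
and the functional calculus are available. -/
def ell2 (G : Type*) : Type _ := lp (fun _ : G => ℂ) 2

namespace ell2

variable {G : Type*}

instance : NormedAddCommGroup (ell2 G) :=
  inferInstanceAs (NormedAddCommGroup (lp (fun _ : G => ℂ) 2))

instance : InnerProductSpace ℂ (ell2 G) :=
  inferInstanceAs (InnerProductSpace ℂ (lp (fun _ : G => ℂ) 2))

instance : CompleteSpace (ell2 G) :=
  inferInstanceAs (CompleteSpace (lp (fun _ : G => ℂ) 2))

instance : CoeFun (ell2 G) fun _ => G → ℂ := ⟨fun u => Subtype.val u⟩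

@[ext]
lemma ext {u v : ell2 G} (h : ∀ i, u i = v i) : u = v := Subtype.ext (funext h)

lemma add_apply (u v : ell2 G) (i : G) : (u + v) i = u i + v i := rfl

lemma smul_apply (c : ℂ) (u : ell2 G) (i : G) : (c • u) i = c * u i := rfl

/-- The sequence `δ_i = (1_{k = i})_k` in `ℓ²(G)`. -/
def delta (i : G) : ell2 G :=
  open Classical in (lp.single 2 i (1 : ℂ) : lp (fun _ : G => ℂ) 2)

lemma delta_apply (i k : G) [Decidable (k = i)] : delta i k = if k = i then 1 else 0 := by
  classical
  have h := lp.single_apply (E := fun _ : G => ℂ) 2 i (1 : ℂ) k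
  rw [Pi.single_apply] at h
  refine Eq.trans ?_ (h.trans ?_)
  · unfold delta
    congr!
  · congr

lemma inner_delta (i : G) (u : ell2 G) : ⟪delta i, u⟫_ℂ = u i := by
  classical
  have h := lp.inner_single_left (𝕜 := ℂ) i (1 : ℂ) (show lp (fun _ : G => ℂ) 2 from u)
  refine Eq.trans ?_ (h.trans ?_)
  · unfold delta
    congr!
  · simp

end ell2

open ell2

namespace WeightedGraph

variable {G : Type*} (Γ : WeightedGraph G)

/-- The degree of the graph: the maximal number of neighbors of a vertex. -/
def deg : ℕ := (⨆ i, {j | Γ.W i j ≠ 0}.encard).toNat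

lemma encard_le_deg (i : G) : {j | Γ.W i j ≠ 0}.encard ≤ (Γ.deg : ℕ∞) := by
  have h : ((⨆ i, {j | Γ.W i j ≠ 0}.encard).toNat : ℕ∞) = ⨆ i, {j | Γ.W i j ≠ 0}.encard :=
    ENat.natCast_toNat Γ.deg_lt_top.ne
  rw [deg, h]
  exact le_iSup (fun i => {j | Γ.W i j ≠ 0}.encard) i

lemma finite_neighbors (i : G) : {j | Γ.W i j ≠ 0}.Finite :=
  Set.finite_of_encard_le_coe (Γ.encard_le_deg i)

lemma sum_abs_le_one (i : G) (s : Finset G) : ∑ j ∈ s, |Γ.W i j| ≤ 1 := by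
  classical
  have h1 : ∑ j ∈ s, |Γ.W i j| = ∑ j ∈ s with Γ.W i j ≠ 0, |Γ.W i j| := by
    rw [Finset.sum_filter_of_ne]
    intro j _ hj h0
    exact hj (by simp [h0])
  have hcard : (s.filter fun j => Γ.W i j ≠ 0).card ≤ Γ.deg := by
    have h2 : ((s.filter fun j => Γ.W i j ≠ 0 : Finset G) : Set G).encard ≤ (Γ.deg : ℕ∞) :=
      (Set.encard_le_encard (by intro j hj; simpa using (by simpa using hj : j ∈ s ∧ _).2)).trans
        (Γ.encard_le_deg i)
    rw [Set.encard_coe_eq_coe_finsetCard] at h2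
    exact_mod_cast h2
  rw [h1]
  calc ∑ j ∈ s with Γ.W i j ≠ 0, |Γ.W i j|
      ≤ (s.filter fun j => Γ.W i j ≠ 0).card • (1 / (Γ.deg : ℝ)) :=
        Finset.sum_le_card_nsmul _ _ _ fun j _ => Γ.abs_le i j
    _ ≤ Γ.deg • (1 / (Γ.deg : ℝ)) := by
        gcongr
    _ ≤ 1 := by
        rw [nsmul_eq_mul, mul_one_div]
        exact div_self_le_one _

lemma tsum_row (i : G) (u : G → ℂ) :
    ∑' j, (Γ.W i j : ℂ) * u j = ∑ j ∈ (Γ.finite_neighbors i).toFinset, (Γ.W i j : ℂ) * u j :=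
  tsum_eq_sum fun j hj => by
    have : Γ.W i j = 0 := by simpa using hj
    simp [this]

lemma norm_row_sq_le (i : G) (u : G → ℂ) :
    ‖∑' j, (Γ.W i j : ℂ) * u j‖ ^ 2
      ≤ ∑ j ∈ (Γ.finite_neighbors i).toFinset, |Γ.W i j| * ‖u j‖ ^ 2 := by
  rw [tsum_row]
  set N := (Γ.finite_neighbors i).toFinset
  have h1 : ‖∑ j ∈ N, (Γ.W i j : ℂ) * u j‖ ≤ ∑ j ∈ N, √|Γ.W i j| * (√|Γ.W i j| * ‖u j‖) := by
    refine (norm_sum_le _ _).trans (Finset.sum_le_sum fun j _ => ?_)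
    rw [norm_mul, Complex.norm_real, Real.norm_eq_abs, ← mul_assoc,
      Real.mul_self_sqrt (abs_nonneg _)]
  calc ‖∑ j ∈ N, (Γ.W i j : ℂ) * u j‖ ^ 2
      ≤ (∑ j ∈ N, √|Γ.W i j| * (√|Γ.W i j| * ‖u j‖)) ^ 2 := by gcongr
    _ ≤ (∑ j ∈ N, √|Γ.W i j| ^ 2) * ∑ j ∈ N, (√|Γ.W i j| * ‖u j‖) ^ 2 :=
        Finset.sum_mul_sq_le_sq_mul_sq _ _ _
    _ = (∑ j ∈ N, |Γ.W i j|) * ∑ j ∈ N, |Γ.W i j| * ‖u j‖ ^ 2 := by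
        simp only [mul_pow, Real.sq_sqrt (abs_nonneg _)]
    _ ≤ 1 * ∑ j ∈ N, |Γ.W i j| * ‖u j‖ ^ 2 := by
        gcongr
        exact Γ.sum_abs_le_one i N
    _ = _ := one_mul _

lemma sum_norm_row_sq_le (u : ell2 G) (s : Finset G) :
    ∑ i ∈ s, ‖∑' j, (Γ.W i j : ℂ) * u j‖ ^ 2 ≤ ‖u‖ ^ 2 := by
  classical
  set T := s.biUnion fun i => (Γ.finite_neighbors i).toFinset
  calc ∑ i ∈ s, ‖∑' j, (Γ.W i j : ℂ) * u j‖ ^ 2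
      ≤ ∑ i ∈ s, ∑ j ∈ (Γ.finite_neighbors i).toFinset, |Γ.W i j| * ‖u j‖ ^ 2 :=
        Finset.sum_le_sum fun i _ => Γ.norm_row_sq_le i u
    _ ≤ ∑ i ∈ s, ∑ j ∈ T, |Γ.W i j| * ‖u j‖ ^ 2 :=
        Finset.sum_le_sum fun i hi => Finset.sum_le_sum_of_subset_of_nonneg
          (Finset.subset_biUnion_of_mem (fun i => (Γ.finite_neighbors i).toFinset) hi)
          fun j _ _ => by positivity
    _ = ∑ j ∈ T, (∑ i ∈ s, |Γ.W j i|) * ‖u j‖ ^ 2 := by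
        rw [Finset.sum_comm]
        refine Finset.sum_congr rfl fun j _ => ?_
        rw [Finset.sum_mul]
        exact Finset.sum_congr rfl fun i _ => by rw [Γ.symm i j]
    _ ≤ ∑ j ∈ T, 1 * ‖u j‖ ^ 2 := by
        gcongr with j _
        exact Γ.sum_abs_le_one j s
    _ ≤ ‖u‖ ^ 2 := by
        have h := lp.sum_rpow_le_norm_rpow (p := 2) (by norm_num)
          (show lp (fun _ : G => ℂ) 2 from u) T
        simp only [ENNReal.toReal_ofNat, Real.rpow_ofNat] at h
        simp only [one_mul]
        exact h

/-- The adjacency operator acting on `ℓ²(G)` by `(W u)_i = ∑_j W_{ij} u_j`. -/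
def op : ell2 G →L[ℂ] ell2 G :=
  LinearMap.mkContinuous
    { toFun := fun u => ⟨fun i => ∑' j, (Γ.W i j : ℂ) * u j,
        memℓp_gen' (C := ‖u‖ ^ 2) fun s => by simpa using Γ.sum_norm_row_sq_le u s⟩
      map_add' := fun u v => by
        ext i
        change ∑' j, (Γ.W i j : ℂ) * (u + v) j
          = ∑' j, (Γ.W i j : ℂ) * u j + ∑' j, (Γ.W i j : ℂ) * v j
        rw [tsum_row, tsum_row, tsum_row, ← Finset.sum_add_distrib]
        exact Finset.sum_congr rfl fun j _ => by rw [add_apply, mul_add]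
      map_smul' := fun c u => by
        ext i
        change ∑' j, (Γ.W i j : ℂ) * (c • u) j = c * ∑' j, (Γ.W i j : ℂ) * u j
        rw [tsum_row, tsum_row, Finset.mul_sum]
        exact Finset.sum_congr rfl fun j _ => by rw [smul_apply]; ring }
    1 fun u => by
      refine lp.norm_le_of_forall_sum_le (by norm_num) (by positivity) fun s => ?_
      simp only [ENNReal.toReal_ofNat, Real.rpow_ofNat, one_mul]
      exact Γ.sum_norm_row_sq_le u s

@[simp]
lemma op_apply (u : ell2 G) (i : G) : Γ.op u i = ∑' j, (Γ.W i j : ℂ) * u j := rfl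

lemma op_delta (i j : G) : Γ.op (delta j) i = (Γ.W i j : ℂ) := by
  classical
  rw [op_apply, tsum_eq_single j]
  · simp [delta]
  · intro k hk
    simp [delta, hk]

lemma isSelfAdjoint_op : IsSelfAdjoint Γ.op := by
  classical
  rw [ContinuousLinearMap.isSelfAdjoint_iff']
  ext v i
  have hδ : Γ.op (delta i)
      = ∑ j ∈ (Γ.finite_neighbors i).toFinset, (Γ.W i j : ℂ) • delta j := by
    ext k
    rw [op_delta, ← inner_delta, inner_sum]
    simp only [inner_smul_right, inner_delta, delta_apply]
    simp [Γ.symm k i]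
  rw [← inner_delta, ContinuousLinearMap.adjoint_inner_right, hδ, sum_inner, op_apply, tsum_row]
  refine Finset.sum_congr rfl fun j _ => ?_
  rw [inner_smul_left, inner_delta, Complex.conj_ofReal]

/-- The spectrum `Sp(W)`, as a set of real numbers. -/
abbrev sp : Set ℝ := spectrum ℝ Γ.op

/-- The operator `𝒦(f) = f(W) = ∫ f dE`, for `f` continuous on `Sp(W)`. -/
def K (f : ℝ → ℝ) : ell2 G →L[ℂ] ell2 G := cfc f Γ.op

/-- The matrix `𝒦_S(f) = (𝒦(f)_{ij})_{i, j ∈ S}`. Since `W` and `f` are real, `𝒦(f)_{ij}` is a real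
number, and taking the real part loses nothing. -/
def Kmat (f : ℝ → ℝ) (S : Finset G) : Matrix S S ℝ :=
  Matrix.of fun i j => (⟪delta (i : G), Γ.K f (delta (j : G))⟫_ℂ).re

/-- The positive linear functional `f ↦ ⟨f(W) δ_i, δ_i⟩` on continuous functions on `Sp(W)`. -/
def spectralFunctional (i : G) : C_c(Γ.sp, ℝ) →ₚ[ℝ] ℝ :=
  PositiveLinearMap.mk₀
    { toFun := fun f =>
        (⟪delta i, cfcHom Γ.isSelfAdjoint_op f.toContinuousMap (delta i)⟫_ℂ).re
      map_add' := fun f g => by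
        have h : (f + g).toContinuousMap = f.toContinuousMap + g.toContinuousMap := rfl
        rw [h, map_add, _root_.add_apply, inner_add_right, Complex.add_re]
      map_smul' := fun c f => by
        have h : (c • f).toContinuousMap = c • f.toContinuousMap := rfl
        rw [h, map_smul, _root_.smul_apply, RCLike.real_smul_eq_coe_smul (K := ℂ),
          inner_smul_right]
        simp }
    fun f hf => by
      have h : 0 ≤ cfcHom Γ.isSelfAdjoint_op f.toContinuousMap :=
        (cfcHom_nonneg_iff Γ.isSelfAdjoint_op).2 fun x => hf x
      exact ((ContinuousLinearMap.nonneg_iff_isPositive _).1 h).re_inner_nonneg_right _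

/-- The spectral measure `μ_ii(ω) = ⟨E(ω) δ_i, δ_i⟩` of `W` at `δ_i`, where `E` is the resolution of
the identity of `W`: the measure on `Sp(W)` with `∫ f dμ_ii = ⟨f(W) δ_i, δ_i⟩` for continuous `f`. -/
def spectralMeasure (i : G) : Measure Γ.sp := RealRMK.rieszMeasure (Γ.spectralFunctional i)

instance (i : G) : IsFiniteMeasure (Γ.spectralMeasure i) := by
  unfold spectralMeasure
  infer_instance

/-- The measure `μ_ii` represents the functional calculus of `W` at `δ_i`. -/
lemma integral_spectralMeasure (i : G) (f : C(Γ.sp, ℝ)) :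
    ∫ x, f x ∂(Γ.spectralMeasure i)
      = (⟪delta i, cfcHom Γ.isSelfAdjoint_op f (delta i)⟫_ℂ).re :=
  RealRMK.integral_rieszMeasure (Γ.spectralFunctional i)
    ⟨f, HasCompactSupport.of_compactSpace f⟩

/-- The averaged spectral measure `(1/|S|) ∑_{i ∈ S} μ_ii`. -/
def averageSpectralMeasure (S : Finset G) : FiniteMeasure Γ.sp :=
  (S.card : ℝ≥0)⁻¹ • ∑ i ∈ S, ⟨Γ.spectralMeasure i, inferInstance⟩

/-- The size of the boundary of `S`: the number of vertices of `S` with a neighbor outside `S`. -/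
def boundaryCard (S : Finset G) : ℕ := {i | i ∈ S ∧ ∃ j, j ∉ S ∧ Γ.W i j ≠ 0}.ncard

/-- The regularity factor `α(f) = ∑_k |f_k| (k + 1)` of `f(x) = ∑_k f_k x^k`, `x ∈ Sp(W)`. It is
`∞` if `f` has no such expansion; if `Sp(W)` is too small to determine the coefficients, the
infimum over all expansions is taken. -/
def regularityFactor (f : ℝ → ℝ) : ℝ≥0∞ :=
  ⨅ (a : ℕ → ℝ) (_ : ∀ x ∈ Γ.sp, HasSum (fun k => a k * x ^ k) (f x)),
    ∑' k, ENNReal.ofReal |a k| * (k + 1)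

/-- The class `ℱ` of positive analytic functions on the convex hull of `Sp(W)`. -/
def densities : Set (ℝ → ℝ) :=
  {f | AnalyticOn ℝ f (convexHull ℝ Γ.sp) ∧ ∀ x ∈ convexHull ℝ Γ.sp, 0 < f x}

/-- The class `ℱ_ρ` of those `f ∈ ℱ` with `α(log f) ≤ ρ`. -/
def regularDensities (ρ : ℝ) : Set (ℝ → ℝ) :=
  {f | f ∈ Γ.densities ∧ Γ.regularityFactor (fun x => Real.log (f x)) ≤ ENNReal.ofReal ρ}

end WeightedGraph
end

open scoped Matrix

/-! Let `M` be the compression of `g(W)` to a finite set `S`. Concavity of the logarithm makes `log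
det M` at least the trace of the compression of `log g(W)`. If `g ≥ c > 0` on the spectrum, a
quadratic lower bound for the logarithm limits the gap to `c⁻²` times `tr 𝒦_S(g²) - tr M²`
(`abs_log_det_Kmat_sub_trace_le`).

This defect is exactly the squared mass that the vectors `g(W) δ_j`, `j ∈ S`, send outside `S`
(`trace_Kmat_sq_sub`). For a power `W^k` the sum of the escaping norms is at most `k` times the
boundary size, since each step leaks only through the boundary. Uniform polynomial approximation
then makes it `o(m_n)` for continuous `g` (`exists_sum_norm_offPart_K_le`).

The normalized trace of the compression of `log g(W)` is the integral of `log g` against the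
averaged spectral measure, and weak convergence gives the limit. -/

/-! ### Linear algebra: logarithm of a determinant against a trace. -/

/-- The trace of a real matrix as a sum of diagonal coefficients in an orthonormal basis. -/
lemma Matrix.sum_dotProduct_mulVec_orthonormalBasis {n : Type*} [Fintype n] [DecidableEq n]
    (A : Matrix n n ℝ) (b : OrthonormalBasis n ℝ (EuclideanSpace ℝ n)) :
    ∑ l, (b l).ofLp ⬝ᵥ A *ᵥ (b l).ofLp = A.trace := by
  have h := LinearMap.trace_eq_sum_inner (Matrix.toEuclideanLin A) b
  rw [Matrix.toEuclideanLin_eq_toLin_orthonormal, Matrix.trace_toLin_eq] at h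
  rw [h]
  refine Finset.sum_congr rfl fun l _ => ?_
  rw [← Matrix.toEuclideanLin_eq_toLin_orthonormal, EuclideanSpace.inner_eq_star_dotProduct]
  simp [dotProduct_comm]

/-- If the quadratic form of `L` is squeezed between the tangents of the logarithm at all `t ≥ c`,
evaluated at `M`, and these tangents minus a multiple of a quadratic error, then the trace of `L`
is close to `log det M`. -/
lemma Matrix.IsHermitian.abs_log_det_sub_trace_le {n : Type*} [Fintype n] [DecidableEq n]
    {M L S : Matrix n n ℝ} (hM : M.IsHermitian) {c κ : ℝ} (hc : 0 < c)
    (hMc : ∀ x : n → ℝ, c * (x ⬝ᵥ x) ≤ x ⬝ᵥ M *ᵥ x)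
    (hup : ∀ t, c ≤ t → ∀ x : n → ℝ,
      x ⬝ᵥ L *ᵥ x ≤ (Real.log t - 1) * (x ⬝ᵥ x) + t⁻¹ * (x ⬝ᵥ M *ᵥ x))
    (hlow : ∀ t, c ≤ t → ∀ x : n → ℝ,
      (Real.log t - 1 - κ * t ^ 2) * (x ⬝ᵥ x) + (t⁻¹ + 2 * κ * t) * (x ⬝ᵥ M *ᵥ x)
        + (-κ) * (x ⬝ᵥ S *ᵥ x) ≤ x ⬝ᵥ L *ᵥ x) :
    0 < M.det ∧ |Real.log M.det - L.trace| ≤ κ * (S.trace - (M * M).trace) := by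
  set b := hM.eigenvectorBasis
  set t := hM.eigenvalues
  have hbb (l) : (b l).ofLp ⬝ᵥ (b l).ofLp = 1 := by
    have h := EuclideanSpace.inner_eq_star_dotProduct (𝕜 := ℝ) (b l) (b l)
    rw [real_inner_self_eq_norm_sq, b.orthonormal.1 l] at h
    simpa using h.symm
  have hMb (l) : M *ᵥ (b l).ofLp = t l • (b l).ofLp := hM.mulVec_eigenvectorBasis l
  have hbM (l) : (b l).ofLp ⬝ᵥ M *ᵥ (b l).ofLp = t l := by
    rw [hMb, dotProduct_smul, hbb, smul_eq_mul, mul_one]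
  have hbMM (l) : (b l).ofLp ⬝ᵥ (M * M) *ᵥ (b l).ofLp = t l ^ 2 := by
    rw [← Matrix.mulVec_mulVec, hMb, Matrix.mulVec_smul, dotProduct_smul, hbM, smul_eq_mul, sq]
  have ht (l) : c ≤ t l := by simpa [hbb, hbM] using hMc (b l).ofLp
  have ht0 (l) : 0 < t l := hc.trans_le (ht l)
  have hdet : M.det = ∏ l, t l := hM.det_eq_prod_eigenvalues
  refine ⟨hdet ▸ Finset.prod_pos fun l _ => ht0 l, ?_⟩
  rw [hdet, Real.log_prod fun l _ => (ht0 l).ne', ← L.sum_dotProduct_mulVec_orthonormalBasis b,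
    ← S.sum_dotProduct_mulVec_orthonormalBasis b,
    ← (M * M).sum_dotProduct_mulVec_orthonormalBasis b, ← Finset.sum_sub_distrib,
    ← Finset.sum_sub_distrib, Finset.mul_sum]
  refine (Finset.abs_sum_le_sum_abs _ _).trans (Finset.sum_le_sum fun l _ => ?_)
  -- With `t` the eigenvalue of the unit eigenvector tested, the upper bound collapses to `log t`
  -- and the lower one to `log t - κ (x ⬝ S x - t²)`.
  have h1 := hup (t l) (ht l) (b l).ofLp
  have h2 := hlow (t l) (ht l) (b l).ofLp
  have h3 : (t l)⁻¹ * t l = 1 := inv_mul_cancel₀ (ht0 l).ne'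
  rw [hbb, hbM] at h1 h2
  rw [hbMM, abs_le]
  constructor <;> nlinarith

open ell2

namespace WeightedGraph

variable {G : Type*} (Γ : WeightedGraph G)

/-! ### Functional calculus, quadratic forms and compressions. -/

lemma isCompact_sp : IsCompact Γ.sp :=
  isCompact_iff_compactSpace.2 inferInstance

lemma isSelfAdjoint_K (f : ℝ → ℝ) : IsSelfAdjoint (Γ.K f) := cfc_predicate f Γ.op

/-- The shape `a + b f + d h` covers both comparison functions for the logarithm: the tangent in
`g`, and its correction by `g²`. -/
lemma K_lin (a b d : ℝ) {f h : ℝ → ℝ} (hf : ContinuousOn f Γ.sp) (hh : ContinuousOn h Γ.sp) :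
    Γ.K (fun y => a + b * f y + d * h y) = a • 1 + b • Γ.K f + d • Γ.K h := by
  have := Γ.isSelfAdjoint_op
  unfold K
  rw [cfc_add (a := Γ.op) (fun y => a + b * f y) (fun y => d * h y),
    cfc_add (a := Γ.op) (fun _ => a) (fun y => b * f y), cfc_const_mul .., cfc_const_mul ..,
    cfc_const .., Algebra.algebraMap_eq_smul_one]

lemma re_inner_K_mono {f h : ℝ → ℝ} (hf : ContinuousOn f Γ.sp) (hh : ContinuousOn h Γ.sp)
    (hfh : ∀ x ∈ Γ.sp, f x ≤ h x) (v : ell2 G) :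
    (⟪v, Γ.K f v⟫_ℂ).re ≤ (⟪v, Γ.K h v⟫_ℂ).re := by
  have h : Γ.K f ≤ Γ.K h := cfc_mono hfh
  have := ((ContinuousLinearMap.le_def _ _).1 h).re_inner_nonneg_right v
  simpa [inner_sub_right] using this

lemma re_inner_K_lin (a b d : ℝ) {f h : ℝ → ℝ} (hf : ContinuousOn f Γ.sp)
    (hh : ContinuousOn h Γ.sp) (v : ell2 G) :
    (⟪v, Γ.K (fun y => a + b * f y + d * h y) v⟫_ℂ).re
      = a * ‖v‖ ^ 2 + b * (⟪v, Γ.K f v⟫_ℂ).re + d * (⟪v, Γ.K h v⟫_ℂ).re := by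
  rw [Γ.K_lin a b d hf hh]
  simp only [_root_.add_apply, _root_.smul_apply, RCLike.real_smul_eq_coe_smul (K := ℂ),
    inner_add_right, inner_smul_right, one_apply_eq_self, inner_self_eq_norm_sq_to_K]
  simp [← Complex.ofReal_pow]

lemma inner_delta_delta [DecidableEq G] (i j : G) :
    ⟪delta i, delta j⟫_ℂ = if i = j then 1 else 0 := by
  rw [inner_delta, delta_apply]

/-- The vector `∑_{i ∈ S} x_i δ_i`. -/
noncomputable def combo {S : Finset G} (x : S → ℝ) : ell2 G := ∑ i, ((x i : ℝ) : ℂ) • delta (i : G)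

/-- Transfers operator inequalities on `ℓ²(G)` to inequalities between quadratic forms of finite
matrices. -/
lemma re_inner_combo {S : Finset G} (T : ell2 G →L[ℂ] ell2 G) (x : S → ℝ) :
    (⟪combo x, T (combo x)⟫_ℂ).re
      = x ⬝ᵥ (Matrix.of fun i j : S => (⟪delta (i : G), T (delta (j : G))⟫_ℂ).re) *ᵥ x := by
  simp only [combo, map_sum, map_smul, sum_inner, inner_sum, inner_smul_left, inner_smul_right,
    Complex.conj_ofReal, Complex.re_sum, Complex.re_ofReal_mul, dotProduct, Matrix.mulVec,
    Matrix.of_apply, Finset.mul_sum]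
  rw [Finset.sum_comm]
  exact Finset.sum_congr rfl fun i _ => Finset.sum_congr rfl fun j _ => by ring

lemma re_inner_combo_K {S : Finset G} (f : ℝ → ℝ) (x : S → ℝ) :
    (⟪combo x, Γ.K f (combo x)⟫_ℂ).re = x ⬝ᵥ Γ.Kmat f S *ᵥ x :=
  re_inner_combo _ x

lemma norm_combo_sq {S : Finset G} (x : S → ℝ) : ‖combo x‖ ^ 2 = x ⬝ᵥ x := by
  classical
  have h := re_inner_combo (1 : ell2 G →L[ℂ] ell2 G) x
  have h1 : (Matrix.of fun i j : S => (⟪delta (i : G), (1 : ell2 G →L[ℂ] ell2 G)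
      (delta (j : G))⟫_ℂ).re) = 1 := by
    ext i j
    simp only [Matrix.of_apply, one_apply_eq_self, inner_delta_delta,
      Matrix.one_apply, Subtype.ext_iff]
    split_ifs <;> simp
  rw [h1, Matrix.one_mulVec, one_apply_eq_self, inner_self_eq_norm_sq_to_K] at h
  rw [← h]
  simp [← Complex.ofReal_pow]

lemma isHermitian_Kmat (f : ℝ → ℝ) (S : Finset G) : (Γ.Kmat f S).IsHermitian := by
  ext i j
  have h : ⟪delta (j : G), Γ.K f (delta (i : G))⟫_ℂ = ⟪Γ.K f (delta (j : G)), delta (i : G)⟫_ℂ := by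
    rw [← ContinuousLinearMap.adjoint_inner_left,
      (ContinuousLinearMap.isSelfAdjoint_iff'.1 (Γ.isSelfAdjoint_K f))]
  simp only [Matrix.conjTranspose_apply, Kmat, Matrix.of_apply, star_trivial]
  rw [h, ← inner_conj_symm, Complex.conj_re]

/-- The logarithm of the determinant of a compression of `g(W)` compared with the trace of the
compression of `(log g)(W)`. -/
lemma abs_log_det_Kmat_sub_trace_le [DecidableEq G] {g : ℝ → ℝ} (hg : ContinuousOn g Γ.sp)
    {c : ℝ} (hc : 0 < c) (hgc : ∀ x ∈ Γ.sp, c ≤ g x) (S : Finset G) :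
    0 < (Γ.Kmat g S).det ∧
      |Real.log (Γ.Kmat g S).det - (Γ.Kmat (fun x => Real.log (g x)) S).trace|
        ≤ (c ^ 2)⁻¹ * ((Γ.Kmat (fun x => g x ^ 2) S).trace
          - (Γ.Kmat g S * Γ.Kmat g S).trace) := by
  have hg0 : ∀ x ∈ Γ.sp, 0 < g x := fun x hx => hc.trans_le (hgc x hx)
  have hlog : ContinuousOn (fun x => Real.log (g x)) Γ.sp := hg.log fun x hx => (hg0 x hx).ne'
  have hsq : ContinuousOn (fun x => g x ^ 2) Γ.sp := hg.pow 2
  refine (Γ.isHermitian_Kmat g S).abs_log_det_sub_trace_le hc (fun x => ?_) (fun t ht x => ?_)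
    fun t ht x => ?_
  · have h := Γ.re_inner_K_mono (f := fun y => c + 0 * g y + 0 * g y) (h := g) (by fun_prop) hg
      (fun y hy => by simpa using hgc y hy) (combo x)
    rw [Γ.re_inner_K_lin _ _ _ hg hg, norm_combo_sq, re_inner_combo_K] at h
    simpa using h
  · have ht0 : 0 < t := hc.trans_le ht
    have h := Γ.re_inner_K_mono (h := fun y => (Real.log t - 1) + t⁻¹ * g y + 0 * g y) hlog
      (by fun_prop) (fun y hy => ?_) (combo x)
    · rw [Γ.re_inner_K_lin _ _ _ hg hg, norm_combo_sq, re_inner_combo_K, re_inner_combo_K] at h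
      simpa using h
    · have h1 := Real.log_le_sub_one_of_pos (div_pos (hg0 y hy) ht0)
      rw [Real.log_div (hg0 y hy).ne' ht0.ne', div_eq_inv_mul] at h1
      linarith
  · have ht0 : 0 < t := hc.trans_le ht
    have h := Γ.re_inner_K_mono (f := fun y => (Real.log t - 1 - (c ^ 2)⁻¹ * t ^ 2)
      + (t⁻¹ + 2 * (c ^ 2)⁻¹ * t) * g y + (-(c ^ 2)⁻¹) * g y ^ 2) (by fun_prop) hlog
      (fun y hy => ?_) (combo x)
    · rwa [Γ.re_inner_K_lin _ _ _ hg hsq, norm_combo_sq, re_inner_combo_K, re_inner_combo_K,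
        re_inner_combo_K] at h
    · have hy0 := hg0 y hy
      -- From `log (y/t) ≥ 1 - t/y`, the error below the tangent at `t` is at most `(y - t)² / (t
      -- y)`, hence at most `c⁻² (y - t)²` because `t` and `y = g` are both at least `c`.
      have h1 := Real.one_sub_inv_le_log_of_pos (div_pos hy0 ht0)
      rw [Real.log_div hy0.ne' ht0.ne', inv_div] at h1
      have h2 : (t * g y)⁻¹ ≤ (c ^ 2)⁻¹ := by
        rw [sq]
        have := hgc y hy
        gcongr
      have h3 := mul_le_mul_of_nonneg_right h2 (sq_nonneg (g y - t))
      have h4 : (t * g y)⁻¹ * (g y - t) ^ 2 = t⁻¹ * g y - 2 + t / g y := by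
        field_simp
        ring
      rw [h4] at h3
      nlinarith

/-! ### Mass escaping from a finite set. -/

/-- The real-linear map removing from `v` the real parts of its coordinates in `S`. -/
noncomputable def offPart (S : Finset G) : ell2 G →ₗ[ℝ] ell2 G where
  toFun v := v - ∑ i ∈ S, (v i).re • delta i
  map_add' u v := by
    simp only [ell2.add_apply, Complex.add_re, add_smul, Finset.sum_add_distrib]
    abel
  map_smul' c v := by
    have h (i : G) : ((c • v) i).re = c * (v i).re := by
      rw [RCLike.real_smul_eq_coe_smul (K := ℂ), ell2.smul_apply]
      simp
    simp only [h, mul_smul, ← Finset.smul_sum, ← smul_sub, RingHom.id_apply]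

lemma offPart_apply (S : Finset G) (v : ell2 G) :
    offPart S v = v - ∑ i ∈ S, (v i).re • delta i := rfl

/-- Pythagoras for the real inner product: the removed vector is the real-orthogonal projection onto
the real span of the `δ_i`, `i ∈ S`. -/
lemma norm_sq_offPart (S : Finset G) (v : ell2 G) :
    ‖offPart S v‖ ^ 2 = ‖v‖ ^ 2 - ∑ i ∈ S, (v i).re ^ 2 := by
  classical
  set w : ell2 G := ∑ i ∈ S, (v i).re • delta i with hw
  have hin (u : ell2 G) : (⟪w, u⟫_ℂ).re = ∑ i ∈ S, (v i).re * (u i).re := by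
    simp only [hw, sum_inner, RCLike.real_smul_eq_coe_smul (K := ℂ), inner_smul_left, inner_delta]
    simp
  have hwi (i : G) (hi : i ∈ S) : (w i).re = (v i).re := by
    rw [← inner_delta, hw, inner_sum]
    simp only [RCLike.real_smul_eq_coe_smul (K := ℂ), inner_smul_right, inner_delta_delta]
    simp [hi]
  have hww : ‖w‖ ^ 2 = ∑ i ∈ S, (v i).re ^ 2 := by
    have h := hin w
    rw [inner_self_eq_norm_sq_to_K] at h
    have h' : ‖w‖ ^ 2 = ∑ i ∈ S, (v i).re * (w i).re := by
      rw [← h]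
      simp [← Complex.ofReal_pow]
    rw [h']
    exact Finset.sum_congr rfl fun i hi => by rw [hwi i hi, sq]
  have hvw : (⟪v, w⟫_ℂ).re = ∑ i ∈ S, (v i).re ^ 2 := by
    rw [← inner_conj_symm, Complex.conj_re, hin]
    exact Finset.sum_congr rfl fun i _ => (sq _).symm
  have h := norm_sub_sq (𝕜 := ℂ) v w
  rw [offPart_apply, h, hww]
  have : RCLike.re ⟪v, w⟫_ℂ = ∑ i ∈ S, (v i).re ^ 2 := hvw
  rw [this]
  ring

lemma norm_offPart_le (S : Finset G) (v : ell2 G) : ‖offPart S v‖ ≤ ‖v‖ := by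
  refine le_of_sq_le_sq ?_ (norm_nonneg v)
  rw [norm_sq_offPart]
  exact sub_le_self _ (Finset.sum_nonneg fun i _ => sq_nonneg _)

lemma norm_delta (i : G) : ‖delta i‖ = 1 := by
  classical
  have h := norm_sq_eq_re_inner (𝕜 := ℂ) (delta i)
  rw [inner_delta_delta, if_pos rfl, RCLike.one_re] at h
  exact (pow_eq_one_iff_of_nonneg (norm_nonneg _) two_ne_zero).1 h

lemma offPart_delta {S : Finset G} {i : G} (hi : i ∈ S) : offPart S (delta i) = 0 := by
  classical
  rw [offPart_apply, Finset.sum_eq_single i]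
  · simp [delta_apply]
  · intro j _ hj
    simp [delta_apply, hj]
  · exact fun h => absurd hi h

lemma norm_op_le_one : ‖Γ.op‖ ≤ 1 := LinearMap.mkContinuous_norm_le _ zero_le_one _

lemma norm_op_pow_delta_le_one (k : ℕ) (i : G) : ‖(Γ.op ^ k) (delta i)‖ ≤ 1 := by
  induction k with
  | zero => simp [norm_delta]
  | succ k ih =>
    rw [pow_succ', mul_apply_eq_comp]
    exact (Γ.op.le_of_opNorm_le Γ.norm_op_le_one _).trans (by rwa [one_mul])

lemma op_delta_eq_sum (j : G) :
    Γ.op (delta j) = ∑ i ∈ (Γ.finite_neighbors j).toFinset, Γ.W i j • delta i := by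
  classical
  ext k
  rw [op_delta, ← inner_delta, inner_sum]
  simp only [RCLike.real_smul_eq_coe_smul (K := ℂ), inner_smul_right, inner_delta_delta]
  simp [Γ.symm j k]

/-- Peeling off the factor of `W` that acts first turns the start `δ_j` into a weighted sum over
neighbours, so an induction on `k` can move the starting vertex. -/
lemma norm_offPart_op_pow_succ_le (S : Finset G) (k : ℕ) (j : G) :
    ‖offPart S ((Γ.op ^ (k + 1)) (delta j))‖
      ≤ ∑ i ∈ (Γ.finite_neighbors j).toFinset,
        |Γ.W j i| * ‖offPart S ((Γ.op ^ k) (delta i))‖ := by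
  rw [pow_succ, mul_apply_eq_comp, op_delta_eq_sum, map_sum, map_sum]
  refine (norm_sum_le _ _).trans (Finset.sum_le_sum fun i _ => ?_)
  rw [RCLike.real_smul_eq_coe_smul (K := ℂ), map_smul, ← RCLike.real_smul_eq_coe_smul (K := ℂ),
    map_smul, norm_smul, Real.norm_eq_abs, Γ.symm]

/-- The part of the powers of `W` leaving `S` is controlled by the boundary of `S`. -/
lemma sum_norm_offPart_op_pow_le (S : Finset G) (k : ℕ) :
    ∑ j ∈ S, ‖offPart S ((Γ.op ^ k) (delta j))‖ ≤ k * Γ.boundaryCard S := by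
  classical
  induction k with
  | zero =>
    refine (Finset.sum_eq_zero fun j hj => ?_).le.trans (by simp)
    simp [offPart_delta hj]
  | succ k ih =>
    set β : G → ℝ := fun i => ‖offPart S ((Γ.op ^ k) (delta i))‖ with hβ
    have hβ1 (i) : β i ≤ 1 := (norm_offPart_le _ _).trans (Γ.norm_op_pow_delta_le_one k i)
    set B := S.filter fun j => ∃ i, i ∉ S ∧ Γ.W j i ≠ 0
    have hB : (Γ.boundaryCard S : ℝ) = B.card := by
      rw [boundaryCard, ← Set.ncard_coe_finset]
      congr 2
      ext j
      simp [B]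
    -- Neighbours inside `S` do not increase the total: by symmetry the column sums of `|W|` are at
    -- most `1`.
    have hin : ∑ j ∈ S, ∑ i ∈ (Γ.finite_neighbors j).toFinset with i ∈ S, |Γ.W j i| * β i
        ≤ ∑ i ∈ S, β i := by
      calc ∑ j ∈ S, ∑ i ∈ (Γ.finite_neighbors j).toFinset with i ∈ S, |Γ.W j i| * β i
          ≤ ∑ j ∈ S, ∑ i ∈ S, |Γ.W j i| * β i :=
            Finset.sum_le_sum fun j _ => Finset.sum_le_sum_of_subset_of_nonneg
              (fun i hi => (Finset.mem_filter.1 hi).2) fun i _ _ => by positivity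
        _ = ∑ i ∈ S, (∑ j ∈ S, |Γ.W i j|) * β i := by
            rw [Finset.sum_comm]
            refine Finset.sum_congr rfl fun i _ => ?_
            rw [Finset.sum_mul]
            exact Finset.sum_congr rfl fun j _ => by rw [Γ.symm]
        _ ≤ ∑ i ∈ S, 1 * β i := by
            gcongr with i _
            exact Γ.sum_abs_le_one i S
        _ = _ := by simp
    -- Only boundary vertices contribute here, each at most `1` since `β ≤ 1` and row sums are at
    -- most `1`.
    have hout : ∑ j ∈ S, ∑ i ∈ (Γ.finite_neighbors j).toFinset with i ∉ S, |Γ.W j i| * β i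
        ≤ Γ.boundaryCard S := by
      rw [hB, Finset.card_eq_sum_ones, Nat.cast_sum, Finset.sum_filter]
      refine Finset.sum_le_sum fun j _ => ?_
      split_ifs with hj
      · rw [Nat.cast_one]
        refine le_trans (Finset.sum_le_sum fun i _ => ?_) (Γ.sum_abs_le_one j _)
        exact mul_le_of_le_one_right (abs_nonneg _) (hβ1 i)
      · rw [Finset.sum_eq_zero]
        intro i hi
        rw [Finset.mem_filter] at hi
        exact absurd ⟨i, hi.2, by simpa using hi.1⟩ hj
    calc ∑ j ∈ S, ‖offPart S ((Γ.op ^ (k + 1)) (delta j))‖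
        ≤ ∑ j ∈ S, ∑ i ∈ (Γ.finite_neighbors j).toFinset, |Γ.W j i| * β i :=
          Finset.sum_le_sum fun j _ => Γ.norm_offPart_op_pow_succ_le S k j
      _ = ∑ j ∈ S, ∑ i ∈ (Γ.finite_neighbors j).toFinset with i ∈ S, |Γ.W j i| * β i
          + ∑ j ∈ S, ∑ i ∈ (Γ.finite_neighbors j).toFinset with i ∉ S, |Γ.W j i| * β i := by
          rw [← Finset.sum_add_distrib]
          exact Finset.sum_congr rfl fun j _ => (Finset.sum_filter_add_sum_filter_not _ _ _).symm
      _ ≤ k * Γ.boundaryCard S + Γ.boundaryCard S := add_le_add (hin.trans ih) hout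
      _ = _ := by push_cast; ring

lemma sum_norm_offPart_aeval_le (S : Finset G) (p : Polynomial ℝ) :
    ∑ j ∈ S, ‖offPart S (Polynomial.aeval Γ.op p (delta j))‖
      ≤ (∑ k ∈ Finset.range (p.natDegree + 1), |p.coeff k| * k) * Γ.boundaryCard S := by
  have h (j : G) : ‖offPart S (Polynomial.aeval Γ.op p (delta j))‖
      ≤ ∑ k ∈ Finset.range (p.natDegree + 1), |p.coeff k| * ‖offPart S ((Γ.op ^ k) (delta j))‖ := by
    rw [Polynomial.aeval_eq_sum_range, _root_.sum_apply, map_sum]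
    refine (norm_sum_le _ _).trans (Finset.sum_le_sum fun k _ => ?_)
    rw [_root_.smul_apply, map_smul, norm_smul, Real.norm_eq_abs]
  calc ∑ j ∈ S, ‖offPart S (Polynomial.aeval Γ.op p (delta j))‖
      ≤ ∑ j ∈ S, ∑ k ∈ Finset.range (p.natDegree + 1), |p.coeff k| * ‖offPart S ((Γ.op ^ k) (delta j))‖ :=
        Finset.sum_le_sum fun j _ => h j
    _ = ∑ k ∈ Finset.range (p.natDegree + 1), |p.coeff k| * ∑ j ∈ S, ‖offPart S ((Γ.op ^ k) (delta j))‖ := by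
        rw [Finset.sum_comm]
        simp only [Finset.mul_sum]
    _ ≤ ∑ k ∈ Finset.range (p.natDegree + 1), |p.coeff k| * (k * Γ.boundaryCard S) := by
        gcongr with k _
        exact Γ.sum_norm_offPart_op_pow_le S k
    _ = _ := by
        rw [Finset.sum_mul]
        exact Finset.sum_congr rfl fun k _ => by ring

/-! ### From polynomials to continuous functions. -/

/-- Uniform approximation by polynomials on the spectrum of `W`. -/
lemma exists_polynomial_near {g : ℝ → ℝ} (hg : ContinuousOn g Γ.sp) {ε : ℝ} (hε : 0 < ε) :
    ∃ p : Polynomial ℝ, ∀ x ∈ Γ.sp, |g x - p.eval x| ≤ ε := by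
  obtain ⟨⟨q, hq⟩, h⟩ := ContinuousMap.exists_mem_subalgebra_near_continuous_of_separatesPoints
    (polynomialFunctions Γ.sp) (polynomialFunctions_separatesPoints Γ.sp) (Γ.sp.domRestrict g)
    hg.domRestrict ε hε
  obtain ⟨p, _, rfl⟩ := hq
  refine ⟨p, fun x hx => ?_⟩
  rw [abs_sub_comm]
  exact (h ⟨x, hx⟩).le

/-- The approximating polynomial depends only on `g` and `ε`, so `C` is uniform in `S`; the
approximation costs `ε` per vertex because removing coordinates is contractive. -/
lemma exists_sum_norm_offPart_K_le {g : ℝ → ℝ} (hg : ContinuousOn g Γ.sp) {ε : ℝ} (hε : 0 < ε) :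
    ∃ C : ℝ, ∀ S : Finset G, ∑ j ∈ S, ‖offPart S (Γ.K g (delta j))‖
      ≤ C * Γ.boundaryCard S + ε * S.card := by
  obtain ⟨p, hp⟩ := Γ.exists_polynomial_near hg hε
  refine ⟨∑ k ∈ Finset.range (p.natDegree + 1), |p.coeff k| * k, fun S => ?_⟩
  have hsa := Γ.isSelfAdjoint_op
  have hn : ‖Γ.K g - Polynomial.aeval Γ.op p‖ ≤ ε := by
    rw [K, ← cfc_polynomial p Γ.op, ← cfc_sub ..]
    exact norm_cfc_le hε.le hp
  have h (j : G) : ‖offPart S (Γ.K g (delta j))‖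
      ≤ ‖offPart S (Polynomial.aeval Γ.op p (delta j))‖ + ε := by
    have h1 : Γ.K g (delta j)
        = Polynomial.aeval Γ.op p (delta j) + (Γ.K g - Polynomial.aeval Γ.op p) (delta j) := by
      simp
    rw [h1, map_add]
    refine (norm_add_le _ _).trans (add_le_add le_rfl ((norm_offPart_le _ _).trans ?_))
    refine (ContinuousLinearMap.le_opNorm _ _).trans ?_
    rwa [norm_delta, mul_one]
  refine (Finset.sum_le_sum fun j _ => h j).trans ?_
  rw [Finset.sum_add_distrib, Finset.sum_const, nsmul_eq_mul, mul_comm (S.card : ℝ)]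
  exact add_le_add (Γ.sum_norm_offPart_aeval_le S p) le_rfl

/-- The `j`-th diagonal entry for `g²` is `‖g(W) δ_j‖²`, while that of the squared compression
counts only the squares of the coordinates lying in `S`. -/
lemma trace_Kmat_sq_sub {g : ℝ → ℝ} (hg : ContinuousOn g Γ.sp) (S : Finset G) :
    (Γ.Kmat (fun x => g x ^ 2) S).trace - (Γ.Kmat g S * Γ.Kmat g S).trace
      = ∑ j ∈ S, ‖offPart S (Γ.K g (delta j))‖ ^ 2 := by
  have hK : Γ.K (fun x => g x ^ 2) = Γ.K g * Γ.K g := by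
    have hsa := Γ.isSelfAdjoint_op
    simp only [K, sq]
    exact cfc_mul g g Γ.op
  have hadj (u v : ell2 G) : ⟪u, Γ.K g v⟫_ℂ = ⟪Γ.K g u, v⟫_ℂ := by
    rw [← ContinuousLinearMap.adjoint_inner_left,
      ContinuousLinearMap.isSelfAdjoint_iff'.1 (Γ.isSelfAdjoint_K g)]
  have hsymm (i j : S) : Γ.Kmat g S i j = Γ.Kmat g S j i := (Γ.isHermitian_Kmat g S).apply j i
  rw [← Finset.sum_coe_sort S fun j => ‖offPart S (Γ.K g (delta j))‖ ^ 2]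
  simp only [Matrix.trace, Matrix.diag_apply, Matrix.mul_apply]
  rw [← Finset.sum_sub_distrib]
  refine Finset.sum_congr rfl fun j _ => ?_
  rw [norm_sq_offPart, ← Finset.sum_coe_sort S fun i => ((Γ.K g (delta j)) i).re ^ 2]
  congr 1
  · rw [Kmat, Matrix.of_apply, hK, mul_apply_eq_comp, hadj,
      inner_self_eq_norm_sq_to_K]
    simp [← Complex.ofReal_pow]
  · refine Finset.sum_congr rfl fun i _ => ?_
    rw [hsymm j i, ← sq, Kmat, Matrix.of_apply, inner_delta]

lemma exists_abs_log_det_Kmat_sub_trace_le [DecidableEq G] {g : ℝ → ℝ}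
    (hg : ContinuousOn g Γ.sp) {c : ℝ} (hc : 0 < c) (hgc : ∀ x ∈ Γ.sp, c ≤ g x) {ε : ℝ}
    (hε : 0 < ε) :
    ∃ C : ℝ, ∀ S : Finset G,
      |Real.log (Γ.Kmat g S).det - (Γ.Kmat (fun x => Real.log (g x)) S).trace|
        ≤ C * Γ.boundaryCard S + ε * S.card := by
  -- The escaping norms are at most `‖Γ.K g‖`, so their squares are bounded linearly; the `+ 1`
  -- keeps `κ` positive for the division `ε / κ`.
  set κ := (c ^ 2)⁻¹ * (‖Γ.K g‖ + 1) with hκ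
  have hκ0 : 0 < κ := by positivity
  obtain ⟨C, hC⟩ := Γ.exists_sum_norm_offPart_K_le hg (div_pos hε hκ0)
  refine ⟨κ * C, fun S => ?_⟩
  have hsq (j : G) : ‖offPart S (Γ.K g (delta j))‖ ^ 2
      ≤ (‖Γ.K g‖ + 1) * ‖offPart S (Γ.K g (delta j))‖ := by
    rw [sq]
    gcongr
    refine (norm_offPart_le _ _).trans (((Γ.K g).le_opNorm _).trans ?_)
    rw [norm_delta]
    linarith
  calc |Real.log (Γ.Kmat g S).det - (Γ.Kmat (fun x => Real.log (g x)) S).trace|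
      ≤ (c ^ 2)⁻¹ * ∑ j ∈ S, ‖offPart S (Γ.K g (delta j))‖ ^ 2 := by
        rw [← Γ.trace_Kmat_sq_sub hg]
        exact (Γ.abs_log_det_Kmat_sub_trace_le hg hc hgc S).2
    _ ≤ (c ^ 2)⁻¹ * ∑ j ∈ S, (‖Γ.K g‖ + 1) * ‖offPart S (Γ.K g (delta j))‖ := by
        gcongr with j _
        exact hsq j
    _ = κ * ∑ j ∈ S, ‖offPart S (Γ.K g (delta j))‖ := by
        rw [← Finset.mul_sum, hκ, mul_assoc]
    _ ≤ κ * (C * Γ.boundaryCard S + ε / κ * S.card) := by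
        gcongr
        exact hC S
    _ = _ := by
        field_simp

/-! ### Spectral measures and passage to the limit. -/

lemma integral_averageSpectralMeasure {f : ℝ → ℝ} (hf : ContinuousOn f Γ.sp) (S : Finset G) :
    ∫ x : Γ.sp, f x ∂(Γ.averageSpectralMeasure S : Measure Γ.sp)
      = (S.card : ℝ)⁻¹ * (Γ.Kmat f S).trace := by
  have hint (i : G) : ∫ x : Γ.sp, f x ∂(Γ.spectralMeasure i)
      = (⟪delta i, Γ.K f (delta i)⟫_ℂ).re := by
    rw [K, cfc_apply f Γ.op Γ.isSelfAdjoint_op hf]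
    exact Γ.integral_spectralMeasure i ⟨_, hf.domRestrict⟩
  have hcont : Continuous fun x : Γ.sp => f x := hf.domRestrict
  have hcoe : (Γ.averageSpectralMeasure S : Measure Γ.sp)
      = (S.card : ℝ≥0)⁻¹ • ∑ i ∈ S, Γ.spectralMeasure i := by
    rw [averageSpectralMeasure, FiniteMeasure.toMeasure_smul]
    exact congrArg _ (FiniteMeasure.toMeasure_sum (s := S)
      (ν := fun i => (⟨Γ.spectralMeasure i, inferInstance⟩ : FiniteMeasure Γ.sp)))
  rw [hcoe, integral_smul_nnreal_measure, integral_finsetSum_measure]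
  · simp only [hint, Matrix.trace, Matrix.diag_apply, Kmat, Matrix.of_apply]
    rw [Finset.sum_coe_sort S fun i => (⟪delta i, Γ.K f (delta i)⟫_ℂ).re, NNReal.smul_def]
    simp
  · exact fun i _ => (BoundedContinuousFunction.mkOfCompact ⟨_, hcont⟩).integrable _

lemma exists_pos_forall_le {g : ℝ → ℝ} (hg : ContinuousOn g Γ.sp) (hg0 : ∀ x ∈ Γ.sp, 0 < g x) :
    ∃ c > 0, ∀ x ∈ Γ.sp, c ≤ g x := by
  -- `G` may be empty here, and then so is the spectrum.
  rcases Γ.sp.eq_empty_or_nonempty with h | h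
  · exact ⟨1, one_pos, by simp [h]⟩
  · obtain ⟨x, hx, hmin⟩ := Γ.isCompact_sp.exists_isMinOn h hg
    exact ⟨g x, hg0 x hx, fun y hy => hmin hy⟩

/-- The normalized difference of `log det` and the trace of the logarithm vanishes in the limit
along finite sets with negligible boundary. -/
lemma tendsto_log_det_Kmat_sub_trace [DecidableEq G] {g : ℝ → ℝ} (hg : ContinuousOn g Γ.sp)
    (hg0 : ∀ x ∈ Γ.sp, 0 < g x) {V : ℕ → Finset G}
    (hboundary : (fun n => (Γ.boundaryCard (V n) : ℝ)) =o[atTop] fun n => ((V n).card : ℝ)) :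
    Tendsto (fun n => ((V n).card : ℝ)⁻¹ * (Real.log (Γ.Kmat g (V n)).det
      - (Γ.Kmat (fun x => Real.log (g x)) (V n)).trace)) atTop (𝓝 0) := by
  obtain ⟨c, hc, hgc⟩ := Γ.exists_pos_forall_le hg hg0
  have h : (fun n => Real.log (Γ.Kmat g (V n)).det
      - (Γ.Kmat (fun x => Real.log (g x)) (V n)).trace) =o[atTop] fun n => ((V n).card : ℝ) := by
    refine Asymptotics.isLittleO_iff.2 fun ε hε => ?_
    obtain ⟨C, hC⟩ := Γ.exists_abs_log_det_Kmat_sub_trace_le hg hc hgc (half_pos hε)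
    filter_upwards [Asymptotics.isLittleO_iff.1 (hboundary.const_mul_left C) (half_pos hε)]
      with n hn
    rw [Real.norm_eq_abs, Real.norm_natCast] at hn ⊢
    have h1 := hC (V n)
    have h2 := le_abs_self (C * (Γ.boundaryCard (V n) : ℝ))
    linarith
  simpa only [div_eq_inv_mul] using h.tendsto_div_nhds_zero

end WeightedGraph

theorem corollaryc {G : Type*} [DecidableEq G] [Countable G] [Infinite G] (Γ : WeightedGraph G)
    (V : ℕ → Finset G) (hV : Monotone V)
    (hboundary : (fun n => (Γ.boundaryCard (V n) : ℝ)) =o[atTop] fun n => ((V n).card : ℝ))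
    (μ : FiniteMeasure Γ.sp)
    (hμ : Tendsto (fun n => Γ.averageSpectralMeasure (V n)) atTop (𝓝 μ))
    (ρ : ℝ) (hρ : 0 < ρ) (g : ℝ → ℝ) (hg : g ∈ Γ.regularDensities ρ) :
    (∀ n, 0 < (Γ.Kmat g (V n)).det) ∧
      Integrable (fun x : Γ.sp => Real.log (g x)) (μ : Measure Γ.sp) ∧
      Tendsto (fun n => 1 / ((V n).card : ℝ) * Real.log (Γ.Kmat g (V n)).det) atTop
        (𝓝 (∫ x : Γ.sp, Real.log (g x) ∂(μ : Measure Γ.sp))) := by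
  have hgc : ContinuousOn g Γ.sp := hg.1.1.continuousOn.mono (subset_convexHull ℝ _)
  have hg0 : ∀ x ∈ Γ.sp, 0 < g x := fun x hx => hg.1.2 x (subset_convexHull ℝ _ hx)
  have hlog : ContinuousOn (fun x => Real.log (g x)) Γ.sp := hgc.log fun x hx => (hg0 x hx).ne'
  -- Compactness of the spectrum makes `log g` a bounded continuous test function, giving
  -- integrability and access to weak convergence.
  set F : BoundedContinuousFunction Γ.sp ℝ :=
    BoundedContinuousFunction.mkOfCompact ⟨_, hlog.domRestrict⟩ with hF
  refine ⟨fun n => ?_, F.integrable _, ?_⟩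
  · obtain ⟨c, hc, hle⟩ := Γ.exists_pos_forall_le hgc hg0
    exact (Γ.abs_log_det_Kmat_sub_trace_le hgc hc hle (V n)).1
  · have h1 := FiniteMeasure.tendsto_iff_forall_integral_tendsto.1 hμ F
    have h2 : Tendsto (fun n => ((V n).card : ℝ)⁻¹ *
        (Γ.Kmat (fun x => Real.log (g x)) (V n)).trace) atTop
        (𝓝 (∫ x : Γ.sp, Real.log (g x) ∂(μ : Measure Γ.sp))) := by
      refine h1.congr fun n => ?_
      exact Γ.integral_averageSpectralMeasure hlog (V n)
    have h3 := (Γ.tendsto_log_det_Kmat_sub_trace hgc hg0 hboundary).add h2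
    rw [zero_add] at h3
    refine h3.congr fun n => ?_
    ring
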